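/- Let $\mathcal C$ be a class of nonrecursive subsets of $\mathbb N$ that contains every weakly 1-generic set. Then $\mathcal C$ can be made into itself: there is a universal left-r.e. numbering $\beta = (\beta_e)_{e\in\mathbb N}$ such that $\{e : \beta_e \in \mathcal C\} \in \mathcal C$. Here, for $A, B \subseteq \mathbb N$, $A \le_{\mathrm{lex}} B$ means that $A = B$ or the least element of the symmetric difference of $A$ and $B$ belongs to $B$. A set $A \subseteq \mathbb N$ is left-r.e. if there is a uniformly recursive sequence of sets $A_0 \le_{\mathrm{lex}} A_1 \le_{\mathrm{lex}} \cdots$ that converges pointwise to $A$. A left-r.e. numbering is a map $e \mapsto \beta_e = \lim_{s\to\infty} \beta_{e,s}$, where the map $(e,s,n) \mapsto \beta_{e,s}(n)$ is recursive and $\{0,1\}$-valued and $\beta_{e,s} \le_{\mathrm{lex}} \beta_{e,s+1}$ for all $e, s$; it is universal if every left-r.e. set is some $\beta_e$. A set $W$ of binary strings is dense if every binary string has an extension in $W$. A set $A \subseteq \mathbb N$ is weakly 1-generic if every dense r.e. set of binary strings contains a finite prefix of the characteristic sequence $A(0)A(1)A(2)\cdots$. -/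

import Mathlib

/-- The lexicographic order on sets of natural numbers: `A = B`, or the least element `x` of the
symmetric difference of `A` and `B` belongs to `B`. -/
def LexLE (A B : Set ℕ) : Prop :=
  A = B ∨ ∃ x, x ∈ B ∧ x ∉ A ∧ ∀ y, y < x → (y ∈ A ↔ y ∈ B)

/-- `A` is left-r.e.: it is the pointwise limit of a uniformly recursive sequence of sets
`{n | a s n = true}` which is nondecreasing in the lexicographic order. -/
def IsLeftRE (A : Set ℕ) : Prop :=
  ∃ a : ℕ → ℕ → Bool,
    Computable (fun p : ℕ × ℕ => a p.1 p.2) ∧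
    (∀ s, LexLE {n | a s n = true} {n | a (s + 1) n = true}) ∧
    ∀ n, ∀ᶠ s in Filter.atTop, (a s n = true ↔ n ∈ A)

/-- `α` is a left-r.e. numbering: there is a recursive `{0,1}`-valued map `e, s, n ↦ a e s n`,
lexicographically nondecreasing in `s`, such that `α e` is the limit over `s` of the sets
`{n | a e s n = true}`. -/
def IsLeftRENumbering (α : ℕ → Set ℕ) : Prop :=
  ∃ a : ℕ → ℕ → ℕ → Bool,
    Computable (fun p : ℕ × ℕ × ℕ => a p.1 p.2.1 p.2.2) ∧
    (∀ e s, LexLE {n | a e s n = true} {n | a e (s + 1) n = true}) ∧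
    ∀ e n, ∀ᶠ s in Filter.atTop, (a e s n = true ↔ n ∈ α e)

/-- A left-r.e. numbering is universal if every left-r.e. set is in its range. -/
def IsUniversalLeftRENumbering (α : ℕ → Set ℕ) : Prop :=
  IsLeftRENumbering α ∧ ∀ A : Set ℕ, IsLeftRE A → ∃ e, α e = A

/-- A class `C` of sets can be made into itself if, for some universal left-r.e. numbering `β`,
the `β`-index set of `C` is a member of `C`. -/
def CanBeMadeIntoItself (C : Set (Set ℕ)) : Prop :=
  ∃ β : ℕ → Set ℕ, IsUniversalLeftRENumbering β ∧ {e | β e ∈ C} ∈ C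

/-- The binary string `σ` is a prefix of the characteristic sequence `A(0)A(1)A(2)...`. -/
def IsStringPrefix (σ : List Bool) (A : Set ℕ) : Prop :=
  ∀ (i : ℕ) (h : i < σ.length), σ[i] = true ↔ i ∈ A

/-- A set of binary strings is dense if every string has an extension in it
(`σ <+: τ` says that `σ` is a prefix of `τ`). -/
def IsDenseStringSet (W : Set (List Bool)) : Prop :=
  ∀ σ : List Bool, ∃ τ ∈ W, σ <+: τ

/-- `A` is weakly 1-generic: it has a prefix in every dense r.e. set of binary strings. -/
def IsWeaklyOneGeneric (A : Set ℕ) : Prop :=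
  ∀ W : Set (List Bool), REPred (fun σ => σ ∈ W) → IsDenseStringSet W →
    ∃ σ ∈ W, IsStringPrefix σ A

open Filter Encodable Nat.Partrec

/-! Take a universal family U of left-r.e. approximations (`exists_universalApprox`). The numbering
β uses sparse indices, the markers, to list all of U, and every other index to control membership in
C. The j-th marker yields exactly the j-th set of U, so nothing is known about whether it enters the
index set. At a non-marker e, β e is up to a prefix 1^n 0 either a left-r.e. weakly 1-generic set
(`exists_isLeftRE_isWeaklyOneGeneric`), hence in C, or the empty set, hence recursive and not in C.
So the index set can be prescribed off the markers by any bit that is a limit of recursive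
approximations.

The prescribed bits make the index set weakly 1-generic whatever happens at the markers
(`MarkerTree.isWeaklyOneGeneric`). Right after the j-th marker m stands a string τ such that every
string of length m + 1 followed by τ meets the j-th r.e. set, provided such a τ exists. The next
marker lies beyond τ, because its code contains the result of the search for τ.

Markers code lists of correct search results, so a true marker is never refuted and a false one
eventually is. An index taken for a marker by mistake must change the sequence it follows. This is
compatible with left-r.e. approximation because the new set is prefixed by enough ones to exceed the
old one lexicographically (`exists_switched`). -/

/-! ### Bounded quantifiers over primitive recursive predicates -/

theorem PrimrecPred.ball_mem {α β : Type*} [Primcodable α] [Primcodable β] {f : α → List β}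
    {R : β → α → Prop} (hf : Primrec f) (hR : PrimrecPred fun p : β × α => R p.1 p.2) :
    PrimrecPred fun a => ∀ x ∈ f a, R x a :=
  PrimrecRel.comp (PrimrecRel.forall_mem_list (R := R) hR) hf Primrec.id

theorem PrimrecPred.bex_mem {α β : Type*} [Primcodable α] [Primcodable β] {f : α → List β}
    {R : β → α → Prop} (hf : Primrec f) (hR : PrimrecPred fun p : β × α => R p.1 p.2) :
    PrimrecPred fun a => ∃ x ∈ f a, R x a :=
  PrimrecRel.comp (PrimrecRel.exists_mem_list (R := R) hR) hf Primrec.id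

theorem PrimrecPred.bforall_lt {α : Type*} [Primcodable α] {f : α → ℕ} {R : ℕ → α → Prop}
    (hf : Primrec f) (hR : PrimrecPred fun p : ℕ × α => R p.1 p.2) :
    PrimrecPred fun a => ∀ x < f a, R x a :=
  (PrimrecPred.ball_mem (Primrec.list_range.comp hf) hR).of_eq fun a => by simp

theorem PrimrecPred.bexists_lt {α : Type*} [Primcodable α] {f : α → ℕ} {R : ℕ → α → Prop}
    (hf : Primrec f) (hR : PrimrecPred fun p : ℕ × α => R p.1 p.2) :
    PrimrecPred fun a => ∃ x < f a, R x a :=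
  (PrimrecPred.bex_mem (Primrec.list_range.comp hf) hR).of_eq fun a => by simp

theorem PrimrecPred.eq_of {α β : Type*} [Primcodable α] [Primcodable β] {f g : α → β}
    (hf : Primrec f) (hg : Primrec g) : PrimrecPred fun a => f a = g a :=
  PrimrecRel.comp (R := Eq) Primrec.eq hf hg

theorem PrimrecPred.lt_of {α : Type*} [Primcodable α] {f g : α → ℕ}
    (hf : Primrec f) (hg : Primrec g) : PrimrecPred fun a => f a < g a :=
  PrimrecRel.comp (R := (· < ·)) Primrec.nat_lt hf hg

theorem PrimrecPred.primrec_decide {α : Type*} [Primcodable α] {p : α → Prop}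
    [DecidablePred p] (hp : PrimrecPred p) : Primrec fun a => decide (p a) :=
  hp.decide

/-! ### Unbounded search and its approximations -/

open scoped Classical in
/-- Bounded search: `w + 1` for the least `w < s` with `R w`, and `0` if there is none. -/
noncomputable def boundedSearch (R : ℕ → Prop) : ℕ → ℕ
  | 0 => 0
  | s + 1 => if boundedSearch R s = 0 then (if R s then s + 1 else 0) else boundedSearch R s

theorem primrec_boundedSearch {α : Type*} [Primcodable α] {R : α → ℕ → Prop}
    (hR : PrimrecPred fun p : α × ℕ => R p.1 p.2) {f : α → ℕ} (hf : Primrec f) :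
    Primrec fun a => boundedSearch (R a) (f a) := by
  classical
  refine (Primrec.nat_rec' (h := fun a p => if p.2 = 0 then (if R a p.1 then p.1 + 1 else 0)
    else p.2) hf (Primrec.const 0) ?_).of_eq ?_
  · have h2 : Primrec fun q : α × ℕ × ℕ => q.2.2 := Primrec.snd.comp Primrec.snd
    have h1 : Primrec fun q : α × ℕ × ℕ => q.2.1 := Primrec.fst.comp Primrec.snd
    exact Primrec.ite (PrimrecPred.eq_of h2 (Primrec.const 0))
      (Primrec.ite (hR.comp (Primrec.fst.pair h1)) (Primrec.succ.comp h1) (Primrec.const 0)) h2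
  · intro a
    induction f a with
    | zero => rfl
    | succ n ih => simp only [boundedSearch, ← ih]

theorem boundedSearch_stable {R : ℕ → Prop} {s t : ℕ} (hst : s ≤ t)
    (h : boundedSearch R s ≠ 0) : boundedSearch R t = boundedSearch R s := by
  induction hst with
  | refl => rfl
  | step _ ih => rw [boundedSearch, if_neg (by rw [ih]; exact h), ih]

theorem boundedSearch_eq_succ {R : ℕ → Prop} {s w : ℕ} (h : boundedSearch R s = w + 1) :
    R w ∧ boundedSearch R (w + 1) = w + 1 := by
  induction s with
  | zero => simp [boundedSearch] at h
  | succ n ih =>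
    have h' := h
    rw [boundedSearch] at h
    split_ifs at h with h1 h2
    · obtain rfl : n = w := by omega
      exact ⟨h2, h'⟩
    · exact ih h

theorem boundedSearch_ne_zero {R : ℕ → Prop} {w : ℕ} (h : R w) :
    boundedSearch R (w + 1) ≠ 0 := by
  rw [boundedSearch]
  split_ifs <;> simp_all

theorem exists_eventually_boundedSearch (R : ℕ → Prop) :
    ∃ h, ∀ᶠ s in atTop, boundedSearch R s = h := by
  by_cases hs : ∃ s, boundedSearch R s ≠ 0
  · obtain ⟨s, hs⟩ := hs
    exact ⟨_, eventually_atTop.2 ⟨s, fun t ht => boundedSearch_stable ht hs⟩⟩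
  · push Not at hs
    exact ⟨0, Eventually.of_forall hs⟩

/-- The value of an unbounded search: `w + 1` for the least `w` with `R w`, or `0`. -/
noncomputable def searchValue (R : ℕ → Prop) : ℕ := (exists_eventually_boundedSearch R).choose

theorem eventually_boundedSearch (R : ℕ → Prop) :
    ∀ᶠ s in atTop, boundedSearch R s = searchValue R :=
  (exists_eventually_boundedSearch R).choose_spec

theorem boundedSearch_eq_searchValue {R : ℕ → Prop} {s : ℕ} (h : boundedSearch R s ≠ 0) :
    boundedSearch R s = searchValue R := by
  obtain ⟨t, ht, hst⟩ := ((eventually_boundedSearch R).and (eventually_ge_atTop s)).exists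
  rw [← ht, boundedSearch_stable hst h]

theorem searchValue_ne_zero {R : ℕ → Prop} {w : ℕ} (h : R w) : searchValue R ≠ 0 := by
  rw [← boundedSearch_eq_searchValue (boundedSearch_ne_zero h)]
  exact boundedSearch_ne_zero h

theorem of_searchValue_eq_succ {R : ℕ → Prop} {w : ℕ} (h : searchValue R = w + 1) : R w := by
  obtain ⟨t, ht⟩ := (eventually_boundedSearch R).exists
  exact (boundedSearch_eq_succ (ht.trans h)).1

/-- At stage `s` nothing contradicts that `h` is the value of the unbounded search for `R`. -/
def SearchConsistent (R : ℕ → Prop) (h s : ℕ) : Prop :=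
  boundedSearch R (if h = 0 then s else h) = h

theorem searchConsistent_searchValue (R : ℕ → Prop) (s : ℕ) :
    SearchConsistent R (searchValue R) s := by
  unfold SearchConsistent
  split_ifs with h
  · by_contra h'
    exact h' (boundedSearch_eq_searchValue (by rwa [h] at h'))
  · obtain ⟨w, hw⟩ := Nat.exists_eq_succ_of_ne_zero h
    obtain ⟨t, ht⟩ := (eventually_boundedSearch R).exists
    rw [hw]
    exact (boundedSearch_eq_succ (ht.trans hw)).2

/-- A wrong guess 0 is refuted once the search succeeds. A wrong nonzero guess fails a test that
does not involve the stage, so it is refuted from the start. -/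
theorem eventually_not_searchConsistent {R : ℕ → Prop} {h : ℕ} (hh : h ≠ searchValue R) :
    ∀ᶠ s in atTop, ¬ SearchConsistent R h s := by
  unfold SearchConsistent
  split_ifs with h0
  · filter_upwards [eventually_boundedSearch R] with s hs
    rw [hs]
    exact hh.symm
  · refine Eventually.of_forall fun _ h' => hh ?_
    rw [← boundedSearch_eq_searchValue (s := h) (by rwa [h']), h']

/-! ### Convergence of lexicographically nondecreasing sequences -/

theorem LexLE.refl (A : Set ℕ) : LexLE A A := Or.inl rfl

/-- A lexicographically nondecreasing sequence of sets converges pointwise. -/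
theorem eventually_const_of_lexLE {a : ℕ → ℕ → Bool}
    (h : ∀ s, LexLE {n | a s n = true} {n | a (s + 1) n = true}) (n : ℕ) :
    ∃ b, ∀ᶠ s in atTop, a s n = b := by
  induction n using Nat.strong_induction_on with
  | _ n ih =>
    choose! b hb using ih
    have hall : ∀ᶠ s in atTop, ∀ y < n, a s y = b y := by
      have := (Finset.eventually_all (l := atTop) (Finset.range n)
        (p := fun y s => a s y = b y)).2 (fun y hy => hb y (Finset.mem_range.1 hy))
      simpa using this
    obtain ⟨s₀, hs₀⟩ := eventually_atTop.1 hall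
    -- Once all smaller bits have settled, bit n can only change from 0 to 1.
    have step : ∀ s ≥ s₀, a s n = true → a (s + 1) n = true := by
      intro s hs hn
      rcases h s with he | ⟨x, hx1, hx0, hlt⟩
      · exact (Set.ext_iff.1 he n).1 hn
      · rcases lt_trichotomy x n with hxn | rfl | hxn
        · exact absurd ((hs₀ s hs x hxn).trans (hs₀ (s + 1) (by omega) x hxn).symm ▸ hx1 :
            a s x = true) hx0
        · exact absurd hn hx0
        · exact (hlt n hxn).1 hn
    by_cases hex : ∃ s ≥ s₀, a s n = true
    · obtain ⟨s, hs, hn⟩ := hex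
      refine ⟨true, eventually_atTop.2 ⟨s, fun t ht => ?_⟩⟩
      induction ht with
      | refl => exact hn
      | @step m hm ihm => exact step m (le_trans hs hm) ihm
    · push Not at hex
      exact ⟨false, eventually_atTop.2 ⟨s₀, fun t ht => by simpa using hex t ht⟩⟩

/-- The pointwise limit of a sequence of sets. -/
def limitSet (a : ℕ → ℕ → Bool) : Set ℕ := {n | ∀ᶠ s in atTop, a s n = true}

theorem eventually_iff_mem_limitSet {a : ℕ → ℕ → Bool} {n : ℕ}
    (h : ∃ b, ∀ᶠ s in atTop, a s n = b) : ∀ᶠ s in atTop, (a s n = true ↔ n ∈ limitSet a) := by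
  obtain ⟨b, hb⟩ := h
  have : n ∈ limitSet a ↔ b = true := by
    refine ⟨fun hn => ?_, fun h => by rwa [h] at hb⟩
    obtain ⟨s, hs, hs'⟩ := (hb.and (hn : ∀ᶠ s in atTop, a s n = true)).exists
    rw [← hs, hs']
  filter_upwards [hb] with s hs
  rw [hs, this]

theorem limitSet_eq {a : ℕ → ℕ → Bool} {A : Set ℕ}
    (h : ∀ n, ∀ᶠ s in atTop, (a s n = true ↔ n ∈ A)) : limitSet a = A := by
  ext n
  refine ⟨fun hn => ?_, fun hn => ?_⟩
  · obtain ⟨s, hs, hs'⟩ := ((h n).and (hn : ∀ᶠ s in atTop, a s n = true)).exists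
    exact hs.1 hs'
  · exact (h n).mono fun s hs => hs.2 hn

/-! ### A universal family of left-r.e. approximations -/

/-- A uniformly recursive family of nondecreasing sequences of finite sets, whose limits exhaust
the left-r.e. sets. -/
structure UniversalApprox where
  approx : ℕ → ℕ → ℕ → Bool
  primrec : Primrec fun p : ℕ × ℕ × ℕ => approx p.1 p.2.1 p.2.2
  mono : ∀ e s, LexLE {n | approx e s n = true} {n | approx e (s + 1) n = true}
  bounded : ∀ e s n, approx e s n = true → n < s
  universal : ∀ A, IsLeftRE A → ∃ e, limitSet (approx e) = A

namespace LexEnum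

/-- The `x`-th bit of the `k`-th set listed by the program `c`, as far as known after `s` steps. -/
def value (c s k x : ℕ) : Option ℕ := (Denumerable.ofNat Code c).evaln s (Nat.pair k x)

/-- The first `k` bits of the `k`-th set listed by the program `c`, at stage `s`. -/
def trunc (c s k x : ℕ) : Bool := decide (x < k) && decide (value c s k x = some 1)

/-- Stage `s` suffices to see the first `k + 1` bits of the set number `k + 1`, and they do not
lexicographically precede the truncation of the set number `k`. -/
def Ready (c s k : ℕ) : Prop :=
  (∀ x < k + 1, (value c s (k + 1) x).isSome = true) ∧
  ((∀ x < k + 1, trunc c s k x = trunc c s (k + 1) x) ∨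
    ∃ x < k + 1, (trunc c s (k + 1) x = true ∧ trunc c s k x = false) ∧
      ∀ y < x, trunc c s k y = trunc c s (k + 1) y)

open scoped Classical in
/-- The index of the set which is the current approximation at stage `s`. -/
noncomputable def pointer (c : ℕ) : ℕ → ℕ
  | 0 => 0
  | s + 1 => if Ready c (s + 1) (pointer c s) then pointer c s + 1 else pointer c s

section

variable {α : Type*} [Primcodable α] {c s k x : α → ℕ}

theorem primrec_value (hc : Primrec c) (hs : Primrec s) (hk : Primrec k) (hx : Primrec x) :
    Primrec fun a => value (c a) (s a) (k a) (x a) :=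
  Code.primrec_evaln.comp ((hs.pair ((Primrec.ofNat Code).comp hc)).pair
    (Primrec₂.natPair.comp hk hx))

theorem primrec_trunc (hc : Primrec c) (hs : Primrec s) (hk : Primrec k) (hx : Primrec x) :
    Primrec fun a => trunc (c a) (s a) (k a) (x a) :=
  Primrec.and.comp (PrimrecPred.lt_of hx hk).primrec_decide
    (PrimrecPred.eq_of (primrec_value hc hs hk hx) (Primrec.const _)).primrec_decide

theorem primrec_ready (hc : Primrec c) (hs : Primrec s) (hk : Primrec k) :
    PrimrecPred fun a => Ready (c a) (s a) (k a) := by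
  have hk1 := Primrec.succ.comp hk
  have lift : ∀ {f : α → ℕ}, Primrec f → Primrec fun p : ℕ × α => f p.2 :=
    fun h => h.comp Primrec.snd
  have lift2 : ∀ {f : α → ℕ}, Primrec f → Primrec fun p : ℕ × ℕ × α => f p.2.2 :=
    fun h => h.comp (Primrec.snd.comp Primrec.snd)
  refine (PrimrecPred.bforall_lt hk1 ?_).and ((PrimrecPred.bforall_lt hk1 ?_).or
    (PrimrecPred.bexists_lt hk1 (PrimrecPred.and (PrimrecPred.and ?_ ?_)
      (PrimrecPred.bforall_lt (R := fun y p => trunc (c p.2) (s p.2) (k p.2) y =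
        trunc (c p.2) (s p.2) (k p.2 + 1) y) Primrec.fst ?_))))
  · exact PrimrecPred.eq_of (Primrec.option_isSome.comp
      (primrec_value (lift hc) (lift hs) (lift hk1) Primrec.fst)) (Primrec.const _)
  · exact PrimrecPred.eq_of (primrec_trunc (lift hc) (lift hs) (lift hk) Primrec.fst)
      (primrec_trunc (lift hc) (lift hs) (lift hk1) Primrec.fst)
  · exact PrimrecPred.eq_of (primrec_trunc (lift hc) (lift hs) (lift hk1) Primrec.fst)
      (Primrec.const _)
  · exact PrimrecPred.eq_of (primrec_trunc (lift hc) (lift hs) (lift hk) Primrec.fst)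
      (Primrec.const _)
  · exact PrimrecPred.eq_of (primrec_trunc (lift2 hc) (lift2 hs) (lift2 hk) Primrec.fst)
      (primrec_trunc (lift2 hc) (lift2 hs) (lift2 hk1) Primrec.fst)

theorem primrec_pointer (hc : Primrec c) (hs : Primrec s) :
    Primrec fun a => pointer (c a) (s a) := by
  classical
  refine (Primrec.nat_rec' (h := fun a p => if Ready (c a) (p.1 + 1) p.2 then p.2 + 1
    else p.2) hs (Primrec.const 0) ?_).of_eq ?_
  · have h2 : Primrec fun q : α × ℕ × ℕ => q.2.2 := Primrec.snd.comp Primrec.snd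
    have h1 : Primrec fun q : α × ℕ × ℕ => q.2.1 := Primrec.fst.comp Primrec.snd
    exact Primrec.ite (primrec_ready (hc.comp Primrec.fst) (Primrec.succ.comp h1) h2)
      (Primrec.succ.comp h2) h2
  · intro a
    induction s a with
    | zero => rfl
    | succ n ih => simp only [pointer, ← ih]

end

theorem value_stable {c s t k x : ℕ} (hst : s ≤ t) (h : (value c s k x).isSome = true) :
    value c t k x = value c s k x := by
  obtain ⟨v, hv⟩ := Option.isSome_iff_exists.1 h
  rw [hv]
  exact Code.evaln_mono hst hv

theorem pointer_defined (c s : ℕ) :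
    ∀ x < pointer c s, (value c s (pointer c s) x).isSome = true := by
  induction s with
  | zero => simp [pointer]
  | succ s ih =>
    rw [pointer]
    split_ifs with h
    · exact h.1
    · intro x hx
      rw [value_stable (Nat.le_succ s) (ih x hx)]
      exact ih x hx

theorem pointer_le_succ (c s : ℕ) : pointer c s ≤ pointer c (s + 1) := by
  conv_rhs => rw [pointer]
  split_ifs <;> omega

theorem pointer_le (c s : ℕ) : pointer c s ≤ s := by
  induction s with
  | zero => simp [pointer]
  | succ s ih => rw [pointer]; split_ifs <;> omega

theorem trunc_stable {c s t k : ℕ} (hst : s ≤ t)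
    (h : ∀ x < k, (value c s k x).isSome = true) (x : ℕ) : trunc c t k x = trunc c s k x := by
  unfold trunc
  by_cases hx : x < k
  · rw [value_stable hst (h x hx)]
  · simp [hx]

theorem trunc_eq_false {c s k x : ℕ} (h : k ≤ x) : trunc c s k x = false := by
  simp [trunc, h]

theorem lexLE_of_ready {c s k : ℕ} (h : Ready c s k) :
    LexLE {n | trunc c s k n = true} {n | trunc c s (k + 1) n = true} := by
  rcases h.2 with h | ⟨x, -, ⟨h1, h0⟩, hlt⟩
  · left
    ext n
    by_cases hn : n < k + 1
    · simp [h n hn]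
    · simp [trunc_eq_false (c := c) (s := s) (k := k) (x := n) (by omega),
        trunc_eq_false (c := c) (s := s) (k := k + 1) (x := n) (by omega)]
  · exact Or.inr ⟨x, h1, by simp [h0], fun y hy => by simp [hlt y hy]⟩

/-- The bits of the current truncation have all been seen, so a later stage does not alter them; the
pointer advances only after the lexicographic comparison has been checked. -/
theorem mono (c s : ℕ) : LexLE {n | trunc c s (pointer c s) n = true}
    {n | trunc c (s + 1) (pointer c (s + 1)) n = true} := by
  have h1 : {n | trunc c s (pointer c s) n = true} =
      {n | trunc c (s + 1) (pointer c s) n = true} := by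
    ext n
    simp [trunc_stable (Nat.le_succ s) (pointer_defined c s) n]
  rw [h1]
  conv => arg 2; rw [pointer]
  split_ifs with h
  · exact lexLE_of_ready h
  · exact LexLE.refl _

variable {b : ℕ → ℕ → Bool} {c : ℕ}

/-- For a program that computes a nondecreasing sequence the pointer never gets stuck, because
truncating the k-th set to k bits preserves the order between consecutive sets. -/
theorem tendsto_pointer (hmono : ∀ s, LexLE {n | b s n = true} {n | b (s + 1) n = true})
    (hb : ∀ k x, ∀ᶠ s in atTop, value c s k x = some (encode (b k x))) :
    Tendsto (pointer c) atTop atTop := by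
  have hm : Monotone (pointer c) := monotone_nat_of_le_succ (pointer_le_succ c)
  refine tendsto_atTop_atTop_of_monotone hm fun k => ?_
  induction k with
  | zero => exact ⟨0, Nat.zero_le _⟩
  | succ k ih =>
    obtain ⟨s, hs⟩ := ih
    have hall : ∀ k', ∀ᶠ s in atTop, ∀ x < k + 1, value c s k' x = some (encode (b k' x)) := by
      intro k'
      have := (Finset.eventually_all (l := atTop) (Finset.range (k + 1))
        (p := fun x s => value c s k' x = some (encode (b k' x)))).2 (fun x _ => hb k' x)
      simpa using this
    obtain ⟨T, hT⟩ := eventually_atTop.1 ((hall k).and (hall (k + 1)))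
    obtain ⟨h0, h1⟩ := hT (max s T + 1) (by omega)
    rcases Nat.lt_or_ge k (pointer c (max s T)) with hk | hk
    · exact ⟨_, hk⟩
    have hk' : pointer c (max s T) = k := le_antisymm hk (hs.trans (hm (le_max_left s T)))
    refine ⟨max s T + 1, ?_⟩
    rw [pointer, hk', if_pos]
    refine ⟨fun x hx => by simp [h1 x hx], ?_⟩
    have t0 : ∀ x < k, trunc c (max s T + 1) k x = b k x := by
      intro x hx
      have : x < k + 1 := by omega
      unfold trunc
      cases hv : b k x <;> simp [hx, h0 x this, hv]
    have t1 : ∀ x < k + 1, trunc c (max s T + 1) (k + 1) x = b (k + 1) x := by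
      intro x hx
      unfold trunc
      cases hv : b (k + 1) x <;> simp [hx, h1 x hx, hv]
    -- Position k is cut off from the k-th set but kept in the next one. If the two sets agree below
    -- k, the truncations are therefore equal or increase at k.
    have tk : trunc c (max s T + 1) k k = false := trunc_eq_false le_rfl
    have case1 : (∀ x < k, b k x = b (k + 1) x) →
        (∀ x < k + 1, trunc c (max s T + 1) k x = trunc c (max s T + 1) (k + 1) x) ∨
        ∃ x < k + 1, (trunc c (max s T + 1) (k + 1) x = true ∧
          trunc c (max s T + 1) k x = false) ∧
          ∀ y < x, trunc c (max s T + 1) k y = trunc c (max s T + 1) (k + 1) y := by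
      intro he
      have he' : ∀ y < k, trunc c (max s T + 1) k y = trunc c (max s T + 1) (k + 1) y :=
        fun y hy => by rw [t0 y hy, t1 y (by omega), he y hy]
      cases hbk : trunc c (max s T + 1) (k + 1) k
      · left
        intro x hx
        rcases Nat.lt_succ_iff_lt_or_eq.1 hx with hx | rfl
        · exact he' x hx
        · rw [tk, hbk]
      · exact Or.inr ⟨k, by omega, ⟨hbk, tk⟩, he'⟩
    rcases hmono k with he | ⟨x, hx1, hx0, hlt⟩
    · refine case1 fun x _ => ?_
      have := Set.ext_iff.1 he x
      simp only [Set.mem_ofPred_eq] at this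
      exact Bool.eq_iff_iff.2 this
    · have hlt' : ∀ y < x, b k y = b (k + 1) y := fun y hy => Bool.eq_iff_iff.2 (hlt y hy)
      rcases Nat.lt_or_ge x k with hxk | hxk
      · right
        refine ⟨x, by omega, ⟨by rw [t1 x (by omega)]; exact hx1, ?_⟩, fun y hy => ?_⟩
        · rw [t0 x hxk]
          simpa using hx0
        · rw [t0 y (by omega), t1 y (by omega), hlt' y hy]
      · exact case1 fun y hy => hlt' y (by omega)

end LexEnum

open LexEnum in
theorem exists_universalApprox : Nonempty UniversalApprox := by
  refine ⟨⟨fun c s x => trunc c s (pointer c s) x, ?_, mono, ?_, ?_⟩⟩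
  · have hs : Primrec fun p : ℕ × ℕ × ℕ => p.2.1 := Primrec.fst.comp Primrec.snd
    exact primrec_trunc Primrec.fst hs (primrec_pointer Primrec.fst hs)
      (Primrec.snd.comp Primrec.snd)
  · intro e s n h
    have : n < pointer e s := by
      by_contra hn
      rw [trunc_eq_false (by omega)] at h
      simp at h
    exact this.trans_le (pointer_le e s)
  · rintro A ⟨b, hb, hmono, hlim⟩
    have hpart : Nat.Partrec fun n => Part.some (encode (b n.unpair.1 n.unpair.2)) := by
      have h : Computable fun n : ℕ => encode (b n.unpair.1 n.unpair.2) :=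
        Computable.encode.comp (hb.comp Computable.unpair)
      exact Partrec.nat_iff.1 h
    obtain ⟨c, hc⟩ := Code.exists_code.1 hpart
    have hval : ∀ k x, ∀ᶠ s in atTop, value (encode c) s k x = some (encode (b k x)) := by
      intro k x
      have : encode (b k x) ∈ c.eval (Nat.pair k x) := by simp [hc]
      obtain ⟨s, hs⟩ := Code.evaln_complete.1 this
      refine eventually_atTop.2 ⟨s, fun t ht => ?_⟩
      simpa [value] using Code.evaln_mono ht hs
    refine ⟨encode c, limitSet_eq fun n => ?_⟩
    have ht := tendsto_pointer hmono hval
    filter_upwards [ht.eventually (hlim n), ht.eventually (eventually_gt_atTop n)] with s hs hn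
    -- The correct value is only known to appear at some later stage t, but the bit is already
    -- defined at s, so it is the same there.
    obtain ⟨t, hst, hv⟩ :=
      ((eventually_ge_atTop s).and (hval (pointer (encode c) s) n)).exists
    rw [value_stable hst (pointer_defined _ s n hn)] at hv
    rw [← hs]
    unfold trunc
    cases hb' : b (pointer (encode c) s) n <;> simp [hn, hv, hb']

/-! ### Padding, and switching between approximations -/

/-- The set with characteristic sequence `1 ^ n 0 A(0) A(1) ...`. -/
def pad (n : ℕ) (A : Set ℕ) : Set ℕ := {x | x < n ∨ n < x ∧ x - n - 1 ∈ A}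

theorem mem_pad {n x : ℕ} {A : Set ℕ} : x ∈ pad n A ↔ x < n ∨ n < x ∧ x - n - 1 ∈ A := Iff.rfl

theorem LexLE.pad {A B : Set ℕ} (h : LexLE A B) (n : ℕ) : LexLE (pad n A) (pad n B) := by
  rcases h with rfl | ⟨x, hB, hA, hlt⟩
  · exact LexLE.refl _
  · refine Or.inr ⟨n + 1 + x, ?_, ?_, fun y hy => ?_⟩
    · rw [mem_pad, show n + 1 + x - n - 1 = x by omega]
      exact Or.inr ⟨by omega, hB⟩
    · rw [mem_pad, show n + 1 + x - n - 1 = x by omega]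
      rintro (h | h)
      · omega
      · exact hA h.2
    · rw [mem_pad, mem_pad]
      by_cases hn : n < y
      · rw [hlt (y - n - 1) (by omega)]
      · simp [hn]

theorem LexLE.of_not_mem {A B : Set ℕ} {N x : ℕ} (hB : ∀ y < N, y ∈ B) (hx : x < N)
    (hA : x ∉ A) : LexLE A B := by
  classical
  have hex : ∃ x, x ∉ A := ⟨x, hA⟩
  have hle : Nat.find hex ≤ x := Nat.find_min' hex hA
  refine Or.inr ⟨Nat.find hex, hB _ (by omega), Nat.find_spec hex, fun y hy => ?_⟩
  exact iff_of_true (not_not.1 (Nat.find_min hex hy)) (hB y (by omega))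

/-- The last stage up to `s` at which the value of `p` changed, or `0`. -/
def lastChange (p : ℕ → ℕ) : ℕ → ℕ
  | 0 => 0
  | s + 1 => if p (s + 1) = p s then lastChange p s else s + 1

theorem lastChange_le (p : ℕ → ℕ) (s : ℕ) : lastChange p s ≤ s := by
  induction s with
  | zero => simp [lastChange]
  | succ s ih => rw [lastChange]; split_ifs <;> omega

theorem lastChange_eq_zero {p : ℕ → ℕ} {q : ℕ} (h : ∀ s, p s = q) (s : ℕ) :
    lastChange p s = 0 := by
  induction s with
  | zero => rfl
  | succ s ih => rw [lastChange, if_pos (by rw [h, h]), ih]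

theorem exists_eventually_lastChange {p : ℕ → ℕ} {q : ℕ} (h : ∀ᶠ s in atTop, p s = q) :
    ∃ n, ∀ᶠ s in atTop, lastChange p s = n := by
  obtain ⟨s, hs⟩ := eventually_atTop.1 h
  refine ⟨lastChange p s, eventually_atTop.2 ⟨s, fun t ht => ?_⟩⟩
  induction ht with
  | refl => rfl
  | @step m hm ih =>
    rw [lastChange, if_pos (by rw [hs m hm, hs (m + 1) (Nat.le_succ_of_le hm)]), ih]

theorem primrec_lastChange {p : ℕ → ℕ → ℕ} (hp : Primrec fun a : ℕ × ℕ => p a.1 a.2) :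
    Primrec fun a : ℕ × ℕ => lastChange (p a.1) a.2 := by
  refine (Primrec.nat_rec' (h := fun a r => if p a.1 (r.1 + 1) = p a.1 r.1 then r.2
    else r.1 + 1) Primrec.snd (Primrec.const 0) ?_).of_eq ?_
  · have he : Primrec fun r : (ℕ × ℕ) × ℕ × ℕ => r.1.1 := Primrec.fst.comp Primrec.fst
    have hs : Primrec fun r : (ℕ × ℕ) × ℕ × ℕ => r.2.1 := Primrec.fst.comp Primrec.snd
    exact Primrec.ite (PrimrecPred.eq_of (hp.comp (he.pair (Primrec.succ.comp hs)))
      (hp.comp (he.pair hs))) (Primrec.snd.comp Primrec.snd) (Primrec.succ.comp hs)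
  · rintro ⟨e, s⟩
    change Nat.rec _ _ s = lastChange (p e) s
    induction s with
    | zero => rfl
    | succ n ih => simp only [lastChange, ← ih]

/-- The characteristic function of `pad n A`, or of `A` itself if `n = 0`. -/
def padBit (n : ℕ) (a : ℕ → Bool) (x : ℕ) : Bool :=
  -- The value 0 of `lastChange` means that no change has occurred, since changes are recorded at
  -- stages s + 1.
  if n = 0 then a x else if x < n then true else if x = n then false else a (x - n - 1)

theorem setOf_padBit (n : ℕ) (a : ℕ → Bool) :
    {x | padBit n a x = true} = if n = 0 then {x | a x = true} else pad n {x | a x = true} := by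
  ext x
  unfold padBit
  split_ifs with h0
  · rfl
  · change (if x < n then true else if x = n then false else a (x - n - 1)) = true ↔ _
    rw [mem_pad]
    rcases lt_trichotomy x n with h | h | h
    · simp [h]
    · simp [h]
    · simp [h, h.not_gt, h.ne']

/-- A numbering whose `e`-th member follows, at stage `s`, the sequence of index `p e s`: each
change of the index is absorbed by a lexicographically larger initial segment. -/
def switched (U : UniversalApprox) (p : ℕ → ℕ → ℕ) (e s x : ℕ) : Bool :=
  padBit (lastChange (p e) s) (U.approx (p e s) s) x

theorem primrec_switched (U : UniversalApprox) {p : ℕ → ℕ → ℕ}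
    (hp : Primrec fun a : ℕ × ℕ => p a.1 a.2) :
    Primrec fun a : ℕ × ℕ × ℕ => switched U p a.1 a.2.1 a.2.2 := by
  have hs : Primrec fun a : ℕ × ℕ × ℕ => a.2.1 := Primrec.fst.comp Primrec.snd
  have hx : Primrec fun a : ℕ × ℕ × ℕ => a.2.2 := Primrec.snd.comp Primrec.snd
  have hes : Primrec fun a : ℕ × ℕ × ℕ => (a.1, a.2.1) := Primrec.fst.pair hs
  have hn := (primrec_lastChange hp).comp hes
  have ha : ∀ {f : ℕ × ℕ × ℕ → ℕ}, Primrec f →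
      Primrec fun a => U.approx (p a.1 a.2.1) a.2.1 (f a) := fun hf =>
    U.primrec.comp ((hp.comp hes).pair (hs.pair hf))
  exact Primrec.ite (PrimrecPred.eq_of hn (Primrec.const 0)) (ha hx)
    (Primrec.ite (PrimrecPred.lt_of hx hn) (Primrec.const true)
      (Primrec.ite (PrimrecPred.eq_of hx hn) (Primrec.const false)
        (ha (Primrec.nat_sub.comp (Primrec.nat_sub.comp hx hn) (Primrec.const 1)))))

theorem switched_mono (U : UniversalApprox) (p : ℕ → ℕ → ℕ) (e s : ℕ) :
    LexLE {n | switched U p e s n = true} {n | switched U p e (s + 1) n = true} := by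
  unfold switched
  by_cases h : p e (s + 1) = p e s
  · rw [lastChange, if_pos h, h, setOf_padBit, setOf_padBit]
    have hm := U.mono (p e s) s
    split_ifs
    · exact hm
    · exact hm.pad _
  · rw [lastChange, if_neg h, setOf_padBit, setOf_padBit, if_neg (Nat.succ_ne_zero s)]
    have hB : ∀ y < s + 1, y ∈ pad (s + 1) {x | U.approx (p e (s + 1)) (s + 1) x = true} :=
      fun y hy => Or.inl hy
    split_ifs
    -- The unpadded set of stage s has only elements below s, so it misses s, which the new prefix
    -- contains.
    · exact LexLE.of_not_mem hB (Nat.lt_succ_self s)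
        fun h => lt_irrefl _ (U.bounded _ _ _ h)
    -- The old padded set has its 0 at the previous change, a position at most s.
    · refine LexLE.of_not_mem hB (Nat.lt_succ_of_le (lastChange_le (p e) s)) ?_
      rw [mem_pad]
      simp

theorem limitSet_padBit {a : ℕ → ℕ → Bool}
    (h : ∀ n, ∃ b, ∀ᶠ s in atTop, a s n = b) (n : ℕ) :
    limitSet (fun s => padBit n (a s)) = if n = 0 then limitSet a else pad n (limitSet a) := by
  refine limitSet_eq fun x => ?_
  filter_upwards [eventually_iff_mem_limitSet (h x),
    eventually_iff_mem_limitSet (h (x - n - 1))] with s h1 h2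
  have := Set.ext_iff.1 (setOf_padBit n (a s)) x
  rw [Set.mem_ofPred_eq] at this
  rw [this]
  split_ifs
  · exact h1
  · rw [mem_pad, mem_pad, Set.mem_ofPred_eq, h2]

/-- An index that never changes gives the intended set exactly, as universality requires. Elsewhere
a finite prefix is harmless, since it preserves both weak 1-genericity and recursiveness of the
empty set. -/
theorem exists_switched (U : UniversalApprox) {p : ℕ → ℕ → ℕ} {q : ℕ → ℕ}
    (hp : Primrec fun a : ℕ × ℕ => p a.1 a.2) (hq : ∀ e, ∀ᶠ s in atTop, p e s = q e) :
    ∃ β, IsLeftRENumbering β ∧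
      (∀ e, (∀ s, p e s = q e) → β e = limitSet (U.approx (q e))) ∧
      ∀ e, β e = limitSet (U.approx (q e)) ∨ ∃ n, β e = pad n (limitSet (U.approx (q e))) := by
  have key : ∀ e n, (∀ᶠ s in atTop, lastChange (p e) s = n) → limitSet (switched U p e) =
      if n = 0 then limitSet (U.approx (q e)) else pad n (limitSet (U.approx (q e))) := by
    intro e n hn
    rw [← limitSet_padBit (fun m => eventually_const_of_lexLE (U.mono (q e)) m) n]
    ext x
    refine eventually_congr ?_
    filter_upwards [hn, hq e] with s h1 h2
    rw [switched, h1, h2]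
  refine ⟨fun e => limitSet (switched U p e), ⟨switched U p, (primrec_switched U hp).to_comp,
    switched_mono U p, fun e n => eventually_iff_mem_limitSet
      (eventually_const_of_lexLE (switched_mono U p e) n)⟩, fun e he => ?_, fun e => ?_⟩
  · exact key e 0 (Eventually.of_forall (lastChange_eq_zero he))
  · obtain ⟨n, hn⟩ := exists_eventually_lastChange (hq e)
    have := key e n hn
    split_ifs at this with h
    · exact Or.inl this
    · exact Or.inr ⟨n, this⟩

/-! ### Enumerating r.e. sets of strings -/

/-- The string `σ` is enumerated by the program `c` within `t` steps. -/
def EnumBy (c t : ℕ) (σ : List Bool) : Prop :=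
  ((Denumerable.ofNat Code c).evaln t (encode σ)).isSome = true

theorem EnumBy.mono {c s t : ℕ} {σ : List Bool} (hst : s ≤ t) (h : EnumBy c s σ) :
    EnumBy c t σ := by
  obtain ⟨v, hv⟩ := Option.isSome_iff_exists.1 h
  exact Option.isSome_iff_exists.2 ⟨v, Code.evaln_mono hst hv⟩

theorem primrec_enumBy {α : Type*} [Primcodable α] {c t : α → ℕ} {σ : α → List Bool}
    (hc : Primrec c) (ht : Primrec t) (hσ : Primrec σ) :
    PrimrecPred fun a => EnumBy (c a) (t a) (σ a) :=
  PrimrecPred.eq_of (Primrec.option_isSome.comp (Code.primrec_evaln.comp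
    ((ht.pair ((Primrec.ofNat Code).comp hc)).pair (Primrec.encode.comp hσ))))
    (Primrec.const _)

theorem exists_enumBy {W : Set (List Bool)} (hW : REPred fun σ => σ ∈ W) :
    ∃ c, ∀ σ, σ ∈ W ↔ ∃ t, EnumBy c t σ := by
  obtain ⟨c, hc⟩ := Code.exists_code.1 hW
  have hdom : ∀ σ, σ ∈ W ↔ (c.eval (encode σ)).Dom := by
    intro σ
    rw [hc]
    simp [Part.assert]
  refine ⟨encode c, fun σ => (hdom σ).trans ?_⟩
  simp only [EnumBy, Denumerable.ofNat_encode, Option.isSome_iff_exists, Part.dom_iff_mem,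
    Code.evaln_complete, Option.mem_def]
  exact exists_comm

/-- The strings σ with 1^n 0 σ in W again form a dense r.e. set. -/
theorem IsWeaklyOneGeneric.pad {A : Set ℕ} (hA : IsWeaklyOneGeneric A) (n : ℕ) :
    IsWeaklyOneGeneric (pad n A) := by
  intro W hW hd
  set g : List Bool → List Bool := fun σ => List.replicate n true ++ false :: σ with hg
  have hgc : Computable g := (Primrec.list_append.comp (Primrec.const _)
    (Primrec.list_cons.comp (Primrec.const _) Primrec.id)).to_comp
  obtain ⟨σ, hσ, hp⟩ := hA {σ | g σ ∈ W} (Partrec.comp hW hgc) (by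
    intro σ
    obtain ⟨τ, hτ, ρ, rfl⟩ := hd (g σ)
    exact ⟨σ ++ ρ, by simpa [hg] using hτ, List.prefix_append _ _⟩)
  refine ⟨g σ, hσ, fun i hi => ?_⟩
  rw [mem_pad]
  rcases lt_trichotomy i n with h | rfl | h
  · simp [hg, h]
  · simp [hg]
  · obtain ⟨k, rfl⟩ : ∃ k, i = n + 1 + k := ⟨i - n - 1, by omega⟩
    have hk : k < σ.length := by
      have : (g σ).length = n + (σ.length + 1) := by simp [hg]
      omega
    have : (g σ)[n + 1 + k] = σ[k] := by
      simp only [hg]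
      rw [List.getElem_append_right (by simp; omega)]
      simp [show n + 1 + k - n = k + 1 by omega]
    rw [this, hp k hk, show n + 1 + k - n - 1 = k by omega]
    simp [show ¬ n + 1 + k < n by omega, show n < n + 1 + k from h]

/-- The string component of a search witness. -/
def witnessString (w : ℕ) : List Bool := (decode₂ (List Bool) w.unpair.1).getD []

theorem primrec_witnessString : Primrec witnessString :=
  Primrec.option_getD.comp (Primrec.decode₂.comp (Primrec.fst.comp Primrec.unpair))
    (Primrec.const [])

@[simp]
theorem witnessString_pair (τ : List Bool) (t : ℕ) :
    witnessString (Nat.pair (encode τ) t) = τ := by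
  simp [witnessString]

/-! ### A left-r.e. weakly 1-generic set -/

namespace LeftGeneric

/-- `w` witnesses that an extension of `σ 1` is enumerated by the program `c`. -/
def Extends (c : ℕ) (σ : List Bool) (w : ℕ) : Prop :=
  EnumBy c w.unpair.2 (σ ++ true :: witnessString w)

/-- Extend `σ` according to the outcome of the search for an extension. -/
def extend (σ : List Bool) (h : ℕ) : List Bool :=
  if h = 0 then σ ++ [false] else σ ++ true :: witnessString (h - 1)

/-- The stage `s` approximation to the string deciding the first `j` requirements. -/
noncomputable def stem (s : ℕ) : ℕ → List Bool
  | 0 => []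
  | j + 1 => extend (stem s j) (boundedSearch (Extends j (stem s j)) s)

/-- The string deciding the first `j` requirements. -/
noncomputable def limitStem : ℕ → List Bool
  | 0 => []
  | j + 1 => extend (limitStem j) (searchValue (Extends j (limitStem j)))

theorem eventually_stem (j : ℕ) : ∀ᶠ s in atTop, stem s j = limitStem j := by
  induction j with
  | zero => exact Eventually.of_forall fun _ => rfl
  | succ j ih =>
    filter_upwards [ih, eventually_boundedSearch (Extends j (limitStem j))] with s h1 h2
    rw [stem, limitStem, h1, h2]

theorem length_lt_extend (σ : List Bool) (h : ℕ) : σ.length < (extend σ h).length := by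
  unfold extend
  split_ifs <;> simp

theorem prefix_extend (σ : List Bool) (h : ℕ) : σ <+: extend σ h := by
  unfold extend
  split_ifs <;> exact List.prefix_append _ _

section

variable {f : ℕ → List Bool} {h : ℕ → ℕ}

theorem prefix_of_le (hf : ∀ j, f (j + 1) = extend (f j) (h j)) {i j : ℕ} (hij : i ≤ j) :
    f i <+: f j := by
  induction hij with
  | refl => exact List.prefix_rfl
  | step _ ih => exact ih.trans (by rw [hf]; exact prefix_extend _ _)

theorem le_length (hf : ∀ j, f (j + 1) = extend (f j) (h j)) (j : ℕ) : j ≤ (f j).length := by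
  induction j with
  | zero => exact Nat.zero_le _
  | succ j ih => rw [hf]; exact ih.trans_lt (length_lt_extend _ _)

/-- The strings are nested, and the one with index x + 1 is long enough to decide position x, so all
of them agree there. -/
theorem getD_eq (hf : ∀ j, f (j + 1) = extend (f j) (h j)) {j x : ℕ} (hx : x < (f j).length) :
    (f (x + 1)).getD x false = (f j)[x] := by
  have hx' : x < (f (x + 1)).length := le_length hf (x + 1)
  rw [List.getD_eq_getElem _ _ hx']
  rcases le_total j (x + 1) with hle | hle
  · exact ((prefix_of_le hf hle).getElem hx).symm
  · exact (prefix_of_le hf hle).getElem hx'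

end

theorem primrec_stem : Primrec fun p : ℕ × ℕ => stem p.1 p.2 := by
  have hext : PrimrecPred fun p : (ℕ × List Bool) × ℕ => Extends p.1.1 p.1.2 p.2 :=
    primrec_enumBy (Primrec.fst.comp Primrec.fst)
      (Primrec.snd.comp (Primrec.unpair.comp Primrec.snd))
      (Primrec.list_append.comp (Primrec.snd.comp Primrec.fst)
        (Primrec.list_cons.comp (Primrec.const _) (primrec_witnessString.comp Primrec.snd)))
  have hextend : Primrec₂ extend :=
    Primrec.ite (PrimrecPred.eq_of Primrec.snd (Primrec.const 0))
      (Primrec.list_append.comp Primrec.fst (Primrec.const _))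
      (Primrec.list_append.comp Primrec.fst (Primrec.list_cons.comp (Primrec.const _)
        (primrec_witnessString.comp (Primrec.nat_sub.comp Primrec.snd (Primrec.const 1)))))
  refine (Primrec.nat_rec' (h := fun p r => extend r.2
    (boundedSearch (Extends r.1 r.2) p.1)) Primrec.snd (Primrec.const []) ?_).of_eq ?_
  · have h2 : Primrec fun q : (ℕ × ℕ) × ℕ × List Bool => q.2.2 :=
      Primrec.snd.comp Primrec.snd
    refine hextend.comp h2 (primrec_boundedSearch
      (R := fun q : (ℕ × ℕ) × ℕ × List Bool => Extends q.2.1 q.2.2) ?_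
      (Primrec.fst.comp Primrec.fst))
    exact hext.comp (Primrec.pair (Primrec.snd.comp Primrec.fst) Primrec.snd)
  · rintro ⟨s, j⟩
    change Nat.rec _ _ j = stem s j
    induction j with
    | zero => rfl
    | succ n ih => simp only [stem, ← ih]

/-- The stage `s` approximation to the generic set. -/
noncomputable def bit (s x : ℕ) : Bool := (stem s (x + 1)).getD x false

theorem bit_mono (s : ℕ) : LexLE {n | bit s n = true} {n | bit (s + 1) n = true} := by
  classical
  have hstem : ∀ s j, stem s (j + 1) =
    extend (stem s j) (boundedSearch (Extends j (stem s j)) s) := fun _ _ => rfl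
  by_cases hall : ∀ j, stem s j = stem (s + 1) j
  · left
    ext x
    simp [bit, hall]
  · push Not at hall
    have hj := Nat.find_spec hall
    have hmin : ∀ i < Nat.find hall, stem s i = stem (s + 1) i := fun i hi =>
      not_not.1 (Nat.find_min hall hi)
    obtain ⟨j, hjeq⟩ : ∃ j, Nat.find hall = j + 1 := by
      refine Nat.exists_eq_succ_of_ne_zero fun h0 => ?_
      rw [h0] at hj
      exact hj rfl
    rw [hjeq] at hj hmin
    have hσ := hmin j (Nat.lt_succ_self j)
    rw [hstem s, hstem (s + 1), ← hσ] at hj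
    -- A nonzero search value is final. At the first stem that changes, the search has thus just
    -- succeeded, and the bit after the common stem goes from 0 to 1.
    have h0 : boundedSearch (Extends j (stem s j)) s = 0 := by
      by_contra h
      exact hj (by rw [boundedSearch_stable (Nat.le_succ s) h])
    have h1 : boundedSearch (Extends j (stem s j)) (s + 1) ≠ 0 :=
      fun h => hj (by rw [h0, h])
    have hlen : (stem s j).length < (stem s (j + 1)).length := length_lt_extend _ _
    have hlen' : (stem s j).length < (stem (s + 1) (j + 1)).length := by
      rw [hσ]
      exact length_lt_extend _ _
    refine Or.inr ⟨(stem s j).length, ?_, ?_, fun y hy => ?_⟩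
    · change (stem (s + 1) ((stem s j).length + 1)).getD (stem s j).length false = true
      rw [getD_eq (hstem (s + 1)) hlen']
      simp only [hstem (s + 1), ← hσ, extend, if_neg h1]
      simp
    · change ¬ (stem s ((stem s j).length + 1)).getD (stem s j).length false = true
      rw [getD_eq (hstem s) hlen]
      simp only [hstem s, extend, if_pos h0]
      simp
    · change (stem s (y + 1)).getD y false = true ↔ (stem (s + 1) (y + 1)).getD y false = true
      rw [getD_eq (hstem s) hy, getD_eq (hstem (s + 1)) (j := j) (by rwa [← hσ])]
      simp only [hσ]

end LeftGeneric

open LeftGeneric in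
theorem exists_isLeftRE_isWeaklyOneGeneric : ∃ A, IsLeftRE A ∧ IsWeaklyOneGeneric A := by
  refine ⟨{x | (limitStem (x + 1)).getD x false = true}, ⟨bit, ?_, bit_mono, fun n => ?_⟩, ?_⟩
  · exact ((Primrec.list_getD false).comp (primrec_stem.comp
      (Primrec.fst.pair (Primrec.succ.comp Primrec.snd))) Primrec.snd).to_comp
  · filter_upwards [eventually_stem (n + 1)] with s hs
    rw [bit, hs]
  · intro W hW hd
    obtain ⟨c, hc⟩ := exists_enumBy hW
    have hne : searchValue (Extends c (limitStem c)) ≠ 0 := by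
      -- By density the stem followed by 1 has an extension in W, so the search for requirement c
      -- succeeds.
      obtain ⟨τ, hτ, ρ, rfl⟩ := hd (limitStem c ++ [true])
      obtain ⟨t, ht⟩ := (hc _).1 hτ
      refine searchValue_ne_zero (w := Nat.pair (encode ρ) t) ?_
      simpa [Extends] using ht
    obtain ⟨w, hw⟩ := Nat.exists_eq_succ_of_ne_zero hne
    have hmem : limitStem (c + 1) ∈ W := by
      rw [limitStem, extend, if_neg hne, hw]
      exact (hc _).2 ⟨_, of_searchValue_eq_succ hw⟩
    refine ⟨_, hmem, fun i hi => ?_⟩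
    rw [Set.mem_ofPred_eq, getD_eq (f := limitStem) (fun _ => rfl) hi]

/-! ### Markers and the bits prescribed between them -/

/-- All binary strings of length `n`. -/
def stringsOfLength : ℕ → List (List Bool)
  | 0 => [[]]
  | n + 1 => (stringsOfLength n).flatMap fun σ => [false :: σ, true :: σ]

theorem mem_stringsOfLength {n : ℕ} {σ : List Bool} :
    σ ∈ stringsOfLength n ↔ σ.length = n := by
  induction n generalizing σ with
  | zero => simp [stringsOfLength]
  | succ n ih =>
    rcases σ with _ | ⟨b, σ⟩
    · simp [stringsOfLength]
    · cases b <;> simp [stringsOfLength, ih]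

theorem primrec_stringsOfLength : Primrec stringsOfLength := by
  refine (Primrec.nat_rec₁ (f := fun _ L => L.flatMap fun σ => [false :: σ, true :: σ]) [[]]
    ?_).of_eq ?_
  · refine Primrec.list_flatMap Primrec.snd ?_
    have hc : ∀ b : Bool, Primrec fun q : (ℕ × List (List Bool)) × List Bool => b :: q.2 :=
      fun b => Primrec.list_cons.comp (Primrec.const b) Primrec.snd
    exact Primrec.list_cons.comp (hc false)
      (Primrec.list_cons.comp (hc true) (Primrec.const []))
  · intro n
    induction n with
    | zero => rfl
    | succ n ih => simp only [stringsOfLength, ← ih]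

namespace MarkerTree

/-- `w` witnesses a string `τ` such that every string of length `m + 1` followed by `τ` has a
prefix enumerated by the program `c`. -/
def Covers (c m w : ℕ) : Prop :=
  ∀ ρ ∈ stringsOfLength (m + 1), ∃ i < (ρ ++ witnessString w).length + 1,
    EnumBy c w.unpair.2 ((ρ ++ witnessString w).take i)

theorem primrec_covers {α : Type*} [Primcodable α] {c m w : α → ℕ}
    (hc : Primrec c) (hm : Primrec m) (hw : Primrec w) :
    PrimrecPred fun a => Covers (c a) (m a) (w a) := by
  have happ : Primrec fun p : List Bool × α => p.1 ++ witnessString (w p.2) :=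
    Primrec.list_append.comp Primrec.fst (primrec_witnessString.comp (hw.comp Primrec.snd))
  refine PrimrecPred.ball_mem (primrec_stringsOfLength.comp (Primrec.succ.comp hm))
    (R := fun ρ a => ∃ i < (ρ ++ witnessString (w a)).length + 1,
      EnumBy (c a) (w a).unpair.2 ((ρ ++ witnessString (w a)).take i))
    (PrimrecPred.bexists_lt (Primrec.succ.comp (Primrec.list_length.comp happ))
      (R := fun i p => EnumBy (c p.2) (w p.2).unpair.2 ((p.1 ++ witnessString (w p.2)).take i))
      ?_)
  exact primrec_enumBy (hc.comp (Primrec.snd.comp Primrec.snd))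
    (Primrec.snd.comp (Primrec.unpair.comp (hw.comp (Primrec.snd.comp Primrec.snd))))
    (Primrec.list_take.comp Primrec.fst (happ.comp Primrec.snd))

/-- Lengthening τ to serve one more string does no harm to the earlier ones, whose enumerated
prefixes remain prefixes. -/
theorem exists_covering {W : Set (List Bool)} (hd : IsDenseStringSet W) {c : ℕ}
    (hc : ∀ σ, σ ∈ W ↔ ∃ t, EnumBy c t σ) (L : List (List Bool)) :
    ∃ τ t, ∀ ρ ∈ L, ∃ i ≤ (ρ ++ τ).length, EnumBy c t ((ρ ++ τ).take i) := by
  induction L with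
  | nil => exact ⟨[], 0, by simp⟩
  | cons ρ L ih =>
    obtain ⟨τ, t, h⟩ := ih
    obtain ⟨_, hσ, ν, rfl⟩ := hd (ρ ++ τ)
    obtain ⟨t', ht'⟩ := (hc _).1 hσ
    refine ⟨τ ++ ν, max t t', fun ρ' hρ' => ?_⟩
    rcases List.mem_cons.1 hρ' with rfl | hρ'
    · refine ⟨_, le_rfl, ?_⟩
      rw [List.take_length, ← List.append_assoc]
      exact ht'.mono (le_max_right _ _)
    · obtain ⟨i, hi, hi'⟩ := h ρ' hρ'
      refine ⟨i, hi.trans (by simp), ?_⟩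
      rw [← List.append_assoc, List.take_append_of_le_length hi]
      exact hi'.mono (le_max_left _ _)

theorem exists_covers {W : Set (List Bool)} (hd : IsDenseStringSet W) {c : ℕ}
    (hc : ∀ σ, σ ∈ W ↔ ∃ t, EnumBy c t σ) (m : ℕ) : ∃ w, Covers c m w := by
  obtain ⟨τ, t, h⟩ := exists_covering hd hc (stringsOfLength (m + 1))
  refine ⟨Nat.pair (encode τ) t, fun ρ hρ => ?_⟩
  obtain ⟨i, hi, hi'⟩ := h ρ hρ
  rw [witnessString_pair, Nat.unpair_pair]
  exact ⟨i, Nat.lt_succ_of_le hi, hi'⟩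

/-- The search performed at the marker with code list `l`. -/
def search (l : List ℕ) : ℕ → Prop := Covers l.length (encode l)

/-- At stage `s`, the list `l` looks like a list of values of the successive searches. -/
def Valid : List ℕ → ℕ → Prop
  | [], _ => True
  | h :: l, s => Valid l s ∧ SearchConsistent (search l) h s

/-- The list of values of the first `j` searches; its code is the `j`-th marker. -/
noncomputable def markerList : ℕ → List ℕ
  | 0 => []
  | j + 1 => searchValue (search (markerList j)) :: markerList j

@[simp]
theorem length_markerList (j : ℕ) : (markerList j).length = j := by
  induction j with
  | zero => rfl
  | succ j ih => simp [markerList, ih]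

/-- Validity at every stage, not just in the limit, is what keeps the index followed at a marker
constant. -/
theorem valid_markerList (j s : ℕ) : Valid (markerList j) s := by
  induction j with
  | zero => trivial
  | succ j ih => exact ⟨ih, searchConsistent_searchValue _ _⟩

theorem eventually_not_valid {l : List ℕ} (hl : l ≠ markerList l.length) :
    ∀ᶠ s in atTop, ¬ Valid l s := by
  induction l with
  | nil => exact absurd rfl hl
  | cons h l ih =>
    by_cases hl' : l = markerList l.length
    · have hh : h ≠ searchValue (search l) := by
        rintro rfl
        apply hl
        rw [List.length_cons, markerList, ← hl']
      exact (eventually_not_searchConsistent hh).mono fun s hs hv => hs hv.2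
    · exact (ih hl').mono fun s hs hv => hs hv.1

theorem eventually_valid_iff (l : List ℕ) :
    ∀ᶠ s in atTop, (Valid l s ↔ l = markerList l.length) := by
  by_cases hl : l = markerList l.length
  · refine Eventually.of_forall fun s => iff_of_true ?_ hl
    rw [hl]
    exact valid_markerList _ s
  · exact (eventually_not_valid hl).mono fun s hs => iff_of_false hs hl

/-- The list coded by a number. -/
def toList (e : ℕ) : List ℕ := Denumerable.ofNat (List ℕ) e

@[simp]
theorem toList_encode (l : List ℕ) : toList (encode l) = l := Denumerable.ofNat_encode l

@[simp]
theorem encode_toList (e : ℕ) : encode (toList e) = e := Denumerable.encode_ofNat e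

theorem primrec_toList : Primrec toList :=
  (Primrec.option_getD.comp (Primrec.decode (α := List ℕ)) (Primrec.const [])).of_eq fun e => by
    rw [Denumerable.decode_eq_ofNat]
    rfl

/-- The code of the `j`-th marker. -/
noncomputable def marker (j : ℕ) : ℕ := encode (markerList j)

theorem toList_marker (j : ℕ) : toList (marker j) = markerList j := toList_encode _

/-- A list carries both parameters of its search: its length is the requirement and its code is the
position. -/
theorem search_markerList (j : ℕ) : search (markerList j) = Covers j (marker j) := by
  rw [search, length_markerList, marker]

theorem marker_succ (j : ℕ) :
    marker (j + 1) = Nat.pair (searchValue (Covers j (marker j))) (marker j) + 1 := by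
  conv_lhs => rw [marker, markerList, encode_list_cons, search_markerList]
  rfl

theorem marker_strictMono : StrictMono marker := by
  refine strictMono_nat_of_lt_succ fun j => ?_
  rw [marker_succ]
  exact Nat.lt_succ_of_le (Nat.right_le_pair _ _)

theorem length_witnessString_le (w : ℕ) : (witnessString w).length ≤ w := by
  unfold witnessString
  cases h : decode₂ (List Bool) w.unpair.1 with
  | none => simp
  | some τ =>
    -- `decode₂` accepts only the actual code of τ, which bounds the length of τ.
    have := mem_decode₂.1 h
    exact (length_le_encode τ).trans (this.le.trans (Nat.unpair_left_le w))

/-- The next marker codes a pair that contains w + 1, and w bounds the length of its string. The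
string therefore fits strictly between the two markers. -/
theorem add_length_lt_marker_succ {j w : ℕ}
    (hw : searchValue (Covers j (marker j)) = w + 1) :
    marker j + (witnessString w).length + 1 < marker (j + 1) := by
  rw [marker_succ, hw]
  have h1 := Nat.add_le_pair (w + 1) (marker j)
  have h2 := length_witnessString_le w
  omega

/-- The string `τ` found by the search at `m` has a `1` at the place of `e`, when written right
after position `m`. -/
def HasBit (h m e : ℕ) : Prop := h ≠ 0 ∧ (witnessString (h - 1)).getD (e - m - 1) false = true

/-- The stage `s` approximation to membership of a non-marker `e` in the generic set. -/
def BitAt (e s : ℕ) : Prop :=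
  ∃ m < e, Valid (toList m) s ∧ HasBit (boundedSearch (search (toList m)) s) m e

/-- Membership of a non-marker `e` in the generic set. -/
def LimitBit (e : ℕ) : Prop :=
  ∃ m < e, toList m = markerList (toList m).length ∧ HasBit (searchValue (search (toList m))) m e

theorem eventually_bitAt_iff (e : ℕ) : ∀ᶠ s in atTop, (BitAt e s ↔ LimitBit e) := by
  have := (Finset.eventually_all (l := atTop) (Finset.range e)
    (p := fun m s => (Valid (toList m) s ↔ toList m = markerList (toList m).length) ∧
      boundedSearch (search (toList m)) s = searchValue (search (toList m)))).2
    fun m _ => (eventually_valid_iff _).and (eventually_boundedSearch _)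
  filter_upwards [this] with s hs
  refine exists_congr fun m => and_congr_right fun hm => ?_
  obtain ⟨h1, h2⟩ := hs m (Finset.mem_range.2 hm)
  rw [h1, h2]

theorem exists_marker_iff (e : ℕ) :
    (∃ j, e = marker j) ↔ toList e = markerList (toList e).length := by
  constructor
  · rintro ⟨j, rfl⟩
    rw [toList_marker, length_markerList]
  · intro h
    exact ⟨(toList e).length, by rw [marker, ← h, encode_toList]⟩

theorem limitBit_iff {j w x : ℕ} (hw : searchValue (Covers j (marker j)) = w + 1)
    (hx : x < (witnessString w).length) :
    LimitBit (marker j + 1 + x) ↔ (witnessString w)[x] = true := by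
  have hlt := add_length_lt_marker_succ hw
  constructor
  · rintro ⟨m, hm, hmark, h0, hbit⟩
    obtain ⟨i, rfl⟩ := (exists_marker_iff m).2 hmark
    rw [toList_marker, search_markerList] at h0 hbit
    obtain ⟨v, hv⟩ := Nat.exists_eq_succ_of_ne_zero h0
    rw [hv] at hbit
    rcases lt_trichotomy i j with hij | rfl | hij
    -- The string of an earlier marker ends before the next marker, so at this position only the
    -- default `false` is read.
    · have h1 := add_length_lt_marker_succ hv
      have h2 := marker_strictMono.monotone (Nat.succ_le_of_lt hij)
      rw [Nat.succ_eq_add_one, Nat.add_sub_cancel, List.getD_eq_default _ _ (by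
        simp only [Nat.succ_eq_add_one] at h2
        omega)] at hbit
      simp at hbit
    · obtain rfl : v = w := by
        rw [hw] at hv
        exact (Nat.succ.inj hv).symm
      rw [Nat.succ_eq_add_one, Nat.add_sub_cancel,
        show marker i + 1 + x - marker i - 1 = x by omega, List.getD_eq_getElem _ _ hx] at hbit
      exact hbit
    · have h2 := marker_strictMono.monotone (Nat.succ_le_of_lt hij)
      simp only [Nat.succ_eq_add_one] at h2
      omega
  · intro h
    refine ⟨marker j, by omega, (exists_marker_iff _).1 ⟨j, rfl⟩, ?_⟩
    rw [toList_marker, search_markerList, hw]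
    refine ⟨Nat.succ_ne_zero w, ?_⟩
    rw [Nat.add_sub_cancel, show marker j + 1 + x - marker j - 1 = x by omega,
      List.getD_eq_getElem _ _ hx]
    exact h

/-- A set which agrees with `LimitBit` off the markers is weakly 1-generic. -/
theorem isWeaklyOneGeneric {G : Set ℕ}
    (hG : ∀ e, (¬ ∃ j, e = marker j) → (e ∈ G ↔ LimitBit e)) : IsWeaklyOneGeneric G := by
  classical
  intro W hW hd
  obtain ⟨j, hj⟩ := exists_enumBy hW
  obtain ⟨w₀, hw₀⟩ := exists_covers hd hj (marker j)
  obtain ⟨w, hw⟩ := Nat.exists_eq_succ_of_ne_zero (searchValue_ne_zero hw₀)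
  -- ρ includes the uncontrolled bit at the marker itself; the search provides for all strings of
  -- length `marker j + 1`.
  set ρ := (List.range (marker j + 1)).map fun x => decide (x ∈ G) with hρ
  have hlen : ρ.length = marker j + 1 := by simp [hρ]
  obtain ⟨i, -, hi⟩ := of_searchValue_eq_succ hw ρ (mem_stringsOfLength.2 hlen)
  refine ⟨_, (hj _).2 ⟨_, hi⟩, fun x hx => ?_⟩
  rw [List.getElem_take]
  have hx' : x < ρ.length + (witnessString w).length := by
    rw [List.length_take, List.length_append] at hx
    omega
  rcases Nat.lt_or_ge x ρ.length with h | h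
  · rw [List.getElem_append_left h]
    simp [hρ]
  · rw [List.getElem_append_right h]
    obtain ⟨k, rfl⟩ : ∃ k, x = marker j + 1 + k := ⟨x - (marker j + 1), by omega⟩
    have hk : k < (witnessString w).length := by omega
    rw [hG, limitBit_iff hw hk]
    · simp [hlen]
    -- The position lies strictly between two consecutive markers.
    · rintro ⟨i, hi⟩
      have hlt := add_length_lt_marker_succ hw
      have h1 : j < i := marker_strictMono.lt_iff_lt.1 (by omega)
      have h2 : i < j + 1 := marker_strictMono.lt_iff_lt.1 (by omega)
      omega

section

theorem primrec_search {α : Type*} [Primcodable α] {l : α → List ℕ} {s : α → ℕ}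
    (hl : Primrec l) (hs : Primrec s) :
    Primrec fun a => boundedSearch (search (l a)) (s a) :=
  primrec_boundedSearch (R := fun a => search (l a))
    (primrec_covers (Primrec.list_length.comp (hl.comp Primrec.fst))
      (Primrec.encode.comp (hl.comp Primrec.fst)) Primrec.snd) hs

theorem primrec_valid : PrimrecPred fun p : List ℕ × ℕ => Valid p.1 p.2 := by
  classical
  refine Primrec.primrecPred ?_
  refine (Primrec.list_rec (f := fun p : List ℕ × ℕ => p.1) (g := fun _ => true)
    (h := fun p r => r.2.2 && decide (SearchConsistent (search r.2.1) r.1 p.2))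
    Primrec.fst (Primrec.const true) ?_).of_eq ?_
  · have hh : Primrec fun q : (List ℕ × ℕ) × ℕ × List ℕ × Bool => q.2.1 :=
      Primrec.fst.comp Primrec.snd
    have hl : Primrec fun q : (List ℕ × ℕ) × ℕ × List ℕ × Bool => q.2.2.1 :=
      Primrec.fst.comp (Primrec.snd.comp Primrec.snd)
    refine Primrec.and.comp (Primrec.snd.comp (Primrec.snd.comp Primrec.snd))
      (PrimrecPred.primrec_decide ?_)
    exact PrimrecPred.eq_of (primrec_search hl (Primrec.ite
      (PrimrecPred.eq_of hh (Primrec.const 0)) (Primrec.snd.comp Primrec.fst) hh)) hh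
  · rintro ⟨l, s⟩
    induction l with
    | nil => exact (decide_eq_true (p := Valid [] s) trivial).symm
    | cons h l ih =>
      exact (congrArg (· && decide (SearchConsistent (search l) h s)) ih).trans
        (Bool.eq_iff_iff.2 (by simp only [Bool.and_eq_true, decide_eq_true_eq]; rfl))

theorem primrec_bitAt : PrimrecPred fun p : ℕ × ℕ => BitAt p.1 p.2 := by
  refine PrimrecPred.bexists_lt Primrec.fst (R := fun m p => Valid (toList m) p.2 ∧
    HasBit (boundedSearch (search (toList m)) p.2) m p.1) ?_
  have hl : Primrec fun q : ℕ × ℕ × ℕ => toList q.1 := primrec_toList.comp Primrec.fst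
  have hs : Primrec fun q : ℕ × ℕ × ℕ => q.2.2 := Primrec.snd.comp Primrec.snd
  have hb := primrec_search hl hs
  refine (primrec_valid.comp (hl.pair hs)).and
    ((PrimrecPred.eq_of hb (Primrec.const 0)).not.and (PrimrecPred.eq_of ?_ (Primrec.const _)))
  exact (Primrec.list_getD false).comp
    (primrec_witnessString.comp (Primrec.nat_sub.comp hb (Primrec.const 1)))
    (Primrec.nat_sub.comp (Primrec.nat_sub.comp (Primrec.fst.comp Primrec.snd) Primrec.fst)
      (Primrec.const 1))

end

/-! ### The index followed at each stage, and the final numbering -/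

open scoped Classical in
/-- The index followed by `e` at stage `s`: its own one while `e` looks like a marker, and
otherwise `i₁` or `i₀` according to the current bit. -/
noncomputable def index (i₀ i₁ e s : ℕ) : ℕ :=
  if Valid (toList e) s then (toList e).length else if BitAt e s then i₁ else i₀

open scoped Classical in
/-- The limit of `index i₀ i₁ e`. -/
noncomputable def limitIndex (i₀ i₁ e : ℕ) : ℕ :=
  if toList e = markerList (toList e).length then (toList e).length
  else if LimitBit e then i₁ else i₀

theorem primrec_index (i₀ i₁ : ℕ) : Primrec fun p : ℕ × ℕ => index i₀ i₁ p.1 p.2 := by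
  classical
  have hl : Primrec fun p : ℕ × ℕ => toList p.1 := primrec_toList.comp Primrec.fst
  exact (Primrec.ite (c := fun p : ℕ × ℕ => Valid (toList p.1) p.2)
    (primrec_valid.comp (hl.pair Primrec.snd)) (Primrec.list_length.comp hl)
    (Primrec.ite (c := fun p : ℕ × ℕ => BitAt p.1 p.2) primrec_bitAt
      (Primrec.const i₁) (Primrec.const i₀))).of_eq fun p => rfl

theorem eventually_index (i₀ i₁ e : ℕ) :
    ∀ᶠ s in atTop, index i₀ i₁ e s = limitIndex i₀ i₁ e := by
  filter_upwards [eventually_valid_iff (toList e), eventually_bitAt_iff e] with s h1 h2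
  unfold index limitIndex
  split_ifs <;> tauto

theorem index_marker (i₀ i₁ j s : ℕ) : index i₀ i₁ (marker j) s = j := by
  rw [index, toList_marker, if_pos (valid_markerList j s), length_markerList]

theorem limitIndex_marker (i₀ i₁ j : ℕ) : limitIndex i₀ i₁ (marker j) = j := by
  rw [limitIndex, toList_marker, length_markerList, if_pos rfl]

end MarkerTree

theorem isLeftRE_empty : IsLeftRE ∅ :=
  ⟨fun _ _ => false, Computable.const false, fun _ => LexLE.refl _, by simp⟩

theorem computablePred_pad_empty (n : ℕ) : ComputablePred fun x => x ∈ pad n ∅ := by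
  have h : PrimrecPred fun x => x < n := PrimrecPred.lt_of Primrec.id (Primrec.const n)
  obtain ⟨_, h⟩ := h.of_eq (q := fun x => x ∈ pad n ∅) fun x => by simp [mem_pad]
  exact ⟨_, h.to_comp⟩

theorem computablePred_empty : ComputablePred fun x : ℕ => x ∈ (∅ : Set ℕ) :=
  ⟨fun _ => isFalse id, Computable.const false⟩

open MarkerTree in
theorem mainTheorem2 (C : Set (Set ℕ))
    (hC : ∀ A ∈ C, ¬ ComputablePred (fun n => n ∈ A))
    (hgen : ∀ A : Set ℕ, IsWeaklyOneGeneric A → A ∈ C) :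
    CanBeMadeIntoItself C := by
  obtain ⟨U⟩ := exists_universalApprox
  obtain ⟨A, hA, hAgen⟩ := exists_isLeftRE_isWeaklyOneGeneric
  obtain ⟨i₀, hi₀⟩ := U.universal _ isLeftRE_empty
  obtain ⟨i₁, hi₁⟩ := U.universal _ hA
  obtain ⟨β, hβ, hstay, hswitch⟩ := exists_switched U (primrec_index i₀ i₁)
    (eventually_index i₀ i₁)
  refine ⟨β, ⟨hβ, fun B hB => ?_⟩, hgen _ (isWeaklyOneGeneric fun e he => ?_)⟩
  · obtain ⟨j, hj⟩ := U.universal B hB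
    refine ⟨marker j, ?_⟩
    -- No switch ever occurs at a marker, so B is obtained without padding.
    rw [hstay, limitIndex_marker, hj]
    intro s
    rw [index_marker, limitIndex_marker]
  · have hs := hswitch e
    rw [limitIndex, if_neg (fun h => he ((exists_marker_iff e).2 h))] at hs
    change β e ∈ C ↔ _
    -- Bit 1 gives a possibly padded weakly 1-generic set, bit 0 a possibly padded empty set.
    split_ifs at hs with hbit
    · rw [hi₁] at hs
      refine iff_of_true (hgen _ ?_) hbit
      rcases hs with hs | ⟨n, hs⟩ <;> rw [hs]
      · exact hAgen
      · exact hAgen.pad n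
    · rw [hi₀] at hs
      refine iff_of_false (fun hmem => hC _ hmem ?_) hbit
      rcases hs with hs | ⟨n, hs⟩ <;> rw [hs]
      · exact computablePred_empty
      · exact computablePred_pad_empty n
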